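/- Let $\varepsilon$ be a primitive cube root of unity, let $\alpha \notin \{0,1\}$ be a cube-free rational integer (that is, no cube of an integer other than $\pm 1$ divides $\alpha$), let $\sqrt[3]{\alpha}$ be any cube root of $\alpha$, and put $K = \mathbb{Q}(\varepsilon, \sqrt[3]{\alpha})$. Let $p$ be a prime number with $p \equiv 3 \pmod 8$, and let $H_K(p,2)$ be the quaternion algebra over $K$ with $K$-basis $1, i, j, ij$ and relations $i^2 = p$, $j^2 = 2$, $ji = -ij$. Then $H_K(p,2)$ is a division algebra if and only if $\left(\frac{-3}{p}\right) = 1$, where $\left(\frac{\cdot}{p}\right)$ denotes the Legendre symbol (with value $0$ at multiples of $p$). -/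

import Mathlib

/-- An integer is cube-free if the only cubes dividing it are the cubes of units
(the analogue of `Squarefree`; in particular `0` is not cube-free). -/
def IsCubefree (n : ℤ) : Prop :=
  ∀ x : ℤ, x ^ 3 ∣ n → IsUnit x

/-- A ring is a division ring if it is nontrivial and each of its nonzero elements
has a two-sided inverse. For an algebra over a field this says that it is a division algebra. -/
def IsDivisionAlgebra (A : Type*) [Ring A] : Prop :=
  Nontrivial A ∧ ∀ x : A, x ≠ 0 → IsUnit x

/-- The quaternion algebra `H_K(a, b)`: the four-dimensional `K`-algebra with basis
`1, i, j, k = i * j` and `i ^ 2 = a`, `j ^ 2 = b`, `j * i = - i * j`. In `QuaternionAlgebra K a 0 b`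
the middle coefficient is that of `i` in `i ^ 2`. -/
abbrev quaternionAlg (K : Type*) [Field K] (a b : K) : Type _ :=
  QuaternionAlgebra K a 0 b

/-! The algebra is a division algebra when its norm form is anisotropic. Put F = ℚ(ε). If (-3/p) =
1, then ε embeds in ℚ_p. Since p ≡ 3 mod 8, 2 is a nonresidue mod p, so values of x² - 2y² have even
valuation and the form is anisotropic over ℚ_p, hence over F. As K/F has degree 1 or 3, a cubic case
of Springer's theorem (`NormFormAnisotropic.of_cubic`) carries this to K. If (-3/p) ≠ 1, then p =
2y² + 3w² in integers (`exists_eq_two_mul_sq_add_three_mul_sq_of_legendreSym`). Since -3 = (2ε + 1)²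
in K, this yields an isotropic vector and hence zero divisors. -/

/-- The norm form `w² - a x² - b y² + a b z²` of the quaternion algebra `(a, b)`. -/
def quaternionNormForm {R : Type*} [CommRing R] (a b w x y z : R) : R :=
  w ^ 2 - a * x ^ 2 - b * y ^ 2 + a * b * z ^ 2

/-- The norm form of the quaternion algebra `(a, b)` over `R` has only the trivial zero. -/
def NormFormAnisotropic {R : Type*} [CommRing R] (a b : R) : Prop :=
  ∀ w x y z : R, quaternionNormForm a b w x y z = 0 → w = 0 ∧ x = 0 ∧ y = 0 ∧ z = 0

theorem quaternionNormForm_map {R S : Type*} [CommRing R] [CommRing S] (f : R →+* S)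
    (a b w x y z : R) :
    f (quaternionNormForm a b w x y z)
      = quaternionNormForm (f a) (f b) (f w) (f x) (f y) (f z) := by
  simp [quaternionNormForm]

theorem NormFormAnisotropic.of_injective {R S : Type*} [CommRing R] [CommRing S] {f : R →+* S}
    (hf : Function.Injective f) {a b : R} (h : NormFormAnisotropic (f a) (f b)) :
    NormFormAnisotropic a b := by
  intro w x y z h0
  have := h (f w) (f x) (f y) (f z) (by rw [← quaternionNormForm_map, h0, map_zero])
  simpa [map_eq_zero_iff f hf] using this

theorem isDivisionAlgebra_quaternionAlg {K : Type*} [Field K] {a b : K}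
    (h : NormFormAnisotropic a b) : IsDivisionAlgebra (quaternionAlg K a b) := by
  refine ⟨⟨0, 1, fun h01 => by simpa using congrArg QuaternionAlgebra.re h01⟩, fun q hq => ?_⟩
  obtain ⟨w, x, y, z⟩ := q
  set n := quaternionNormForm a b w x y z with hn
  have hn0 : n ≠ 0 := by
    intro h0
    obtain ⟨rfl, rfl, rfl, rfl⟩ := h w x y z h0
    exact hq rfl
  refine ⟨⟨⟨w, x, y, z⟩, ⟨w / n, -x / n, -y / n, -z / n⟩, ?_, ?_⟩, rfl⟩ <;>
  · ext <;> simp <;> field_simp <;> rw [hn, quaternionNormForm] <;> ring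

/-- The norm form vanishes at (t, 1, y, 1), so this nonzero quaternion is killed by its conjugate.
-/
theorem not_isDivisionAlgebra_quaternionAlg {K : Type*} [Field K] {a b t y : K}
    (h : t ^ 2 = a + b * y ^ 2 - a * b) : ¬ IsDivisionAlgebra (quaternionAlg K a b) := by
  rintro ⟨-, hu⟩
  have h1 := hu (⟨t, 1, y, 1⟩ : quaternionAlg K a b) fun h0 => by
    simpa using congrArg QuaternionAlgebra.imI h0
  have h2 : (⟨t, 1, y, 1⟩ : quaternionAlg K a b) * ⟨t, -1, -y, -1⟩ = 0 := by
    ext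
    · simp
      linear_combination h
    all_goals simp <;> ring
  have h3 := (h1.mul_right_eq_zero).1 h2
  simpa using congrArg QuaternionAlgebra.imI h3

/-! ### Springer's theorem for cubic extensions -/

section Springer

open Polynomial

variable {F : Type*} [Field F] {a b : F}

theorem NormFormAnisotropic.polynomial [Infinite F] (h : NormFormAnisotropic a b) :
    NormFormAnisotropic (C a) (C b) := by
  intro w x y z h0
  have key (r : F) := h (w.eval r) (x.eval r) (y.eval r) (z.eval r) (by
    simpa [quaternionNormForm] using congrArg (eval r) h0)
  exact ⟨funext fun r => by simpa using (key r).1, funext fun r => by simpa using (key r).2.1,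
    funext fun r => by simpa using (key r).2.2.1, funext fun r => by simpa using (key r).2.2.2⟩

theorem natDegree_quaternionNormForm_le {n : ℕ} {w x y z : F[X]} (hw : w.natDegree ≤ n)
    (hx : x.natDegree ≤ n) (hy : y.natDegree ≤ n) (hz : z.natDegree ≤ n) :
    (quaternionNormForm (C a) (C b) w x y z).natDegree ≤ 2 * n := by
  have sq {f : F[X]} (hf : f.natDegree ≤ n) : (f ^ 2).natDegree ≤ 2 * n :=
    natDegree_pow_le_of_le 2 hf
  rw [quaternionNormForm, ← C_mul]
  have sq' {f : F[X]} (c : F) (hf : f.natDegree ≤ n) : (C c * f ^ 2).natDegree ≤ 2 * n :=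
    (natDegree_C_mul_le _ _).trans (sq hf)
  refine natDegree_add_le_of_degree_le ?_ (sq' _ hz)
  exact (natDegree_sub_le_of_le (natDegree_sub_le_of_le (sq hw) (sq' _ hx))
    (sq' _ hy)).trans (by simp)

theorem coeff_quaternionNormForm {n : ℕ} {w x y z : F[X]} (hw : w.natDegree ≤ n)
    (hx : x.natDegree ≤ n) (hy : y.natDegree ≤ n) (hz : z.natDegree ≤ n) :
    (quaternionNormForm (C a) (C b) w x y z).coeff (2 * n)
      = quaternionNormForm a b (w.coeff n) (x.coeff n) (y.coeff n) (z.coeff n) := by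
  have sq {f : F[X]} (hf : f.natDegree ≤ n) : (f ^ 2).coeff (2 * n) = f.coeff n ^ 2 :=
    coeff_pow_of_natDegree_le hf
  rw [quaternionNormForm, quaternionNormForm, ← C_mul]
  simp only [coeff_add, coeff_sub, coeff_C_mul, sq hw, sq hx, sq hy, sq hz]

theorem NormFormAnisotropic.eq_zero_of_dvd_of_natDegree_le_one [Infinite F] (h : NormFormAnisotropic a b)
    {m : F[X]} (hm : m.natDegree = 3) {w x y z : F[X]} (hw : w.natDegree ≤ 1)
    (hx : x.natDegree ≤ 1) (hy : y.natDegree ≤ 1) (hz : z.natDegree ≤ 1)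
    (hdvd : m ∣ quaternionNormForm (C a) (C b) w x y z) : w = 0 ∧ x = 0 ∧ y = 0 ∧ z = 0 := by
  refine h.polynomial w x y z (eq_zero_of_dvd_of_natDegree_lt hdvd ?_)
  have := natDegree_quaternionNormForm_le (a := a) (b := b) hw hx hy hz
  omega

theorem natDegree_le_one_of_coeff_two {f : F[X]} (hf : f.natDegree ≤ 2) (h : f.coeff 2 = 0) :
    f.natDegree ≤ 1 := by
  rw [natDegree_le_iff_coeff_eq_zero] at hf ⊢
  intro N hN
  rcases eq_or_lt_of_le (Nat.succ_le_of_lt hN) with rfl | hN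
  · exact h
  · exact hf N hN

theorem exists_eq_X_sub_C_mul {f : F[X]} {r : F} (hf : f.natDegree ≤ 2) (h : f.eval r = 0) :
    ∃ g : F[X], f = (X - C r) * g ∧ g.natDegree ≤ 1 := by
  obtain ⟨g, rfl⟩ := dvd_iff_isRoot.2 h
  refine ⟨g, rfl, ?_⟩
  rcases eq_or_ne g 0 with rfl | hg
  · simp
  · rw [natDegree_mul (X_sub_C_ne_zero r) hg, natDegree_X_sub_C] at hf
    omega

/-- The value has degree at most 4, so the cofactor g of m has degree at most 1. If g is constant,
the degree-4 coefficient vanishes, and anisotropy kills the quadratic coefficients. If g has a root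
r, anisotropy makes r a common root, and X - r can be divided out, being coprime to m. Either way
the entries become linear, and a value of degree at most 2 divisible by m is zero. -/
theorem NormFormAnisotropic.eq_zero_of_dvd_of_natDegree_le_two [Infinite F] (h : NormFormAnisotropic a b)
    {m : F[X]} (hirr : Irreducible m) (hm : m.natDegree = 3) {w x y z : F[X]}
    (hw : w.natDegree ≤ 2) (hx : x.natDegree ≤ 2) (hy : y.natDegree ≤ 2) (hz : z.natDegree ≤ 2)
    (hdvd : m ∣ quaternionNormForm (C a) (C b) w x y z) : w = 0 ∧ x = 0 ∧ y = 0 ∧ z = 0 := by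
  obtain ⟨g, hg⟩ := hdvd
  rcases eq_or_ne g 0 with rfl | hg0
  · exact h.polynomial w x y z (by rw [hg, mul_zero])
  have hdeg := natDegree_quaternionNormForm_le (a := a) (b := b) hw hx hy hz
  have hmul : (quaternionNormForm (C a) (C b) w x y z).natDegree = 3 + g.natDegree := by
    rw [hg, natDegree_mul hirr.ne_zero hg0, hm]
  rcases Nat.eq_zero_or_pos g.natDegree with hg1 | hg1
  · obtain ⟨h1, h2, h3, h4⟩ := h _ _ _ _ ((coeff_quaternionNormForm hw hx hy hz).symm.trans
      (coeff_eq_zero_of_natDegree_lt (by omega)))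
    exact h.eq_zero_of_dvd_of_natDegree_le_one hm (natDegree_le_one_of_coeff_two hw h1)
      (natDegree_le_one_of_coeff_two hx h2) (natDegree_le_one_of_coeff_two hy h3)
      (natDegree_le_one_of_coeff_two hz h4) ⟨g, hg⟩
  · obtain ⟨r, hr⟩ := exists_root_of_degree_eq_one
      ((degree_eq_iff_natDegree_eq hg0).2 (show g.natDegree = 1 by omega))
    obtain ⟨h1, h2, h3, h4⟩ := h (w.eval r) (x.eval r) (y.eval r) (z.eval r) (by
      have := congrArg (eval r) hg
      rw [eval_mul, hr.eq_zero, mul_zero] at this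
      simpa [quaternionNormForm] using this)
    obtain ⟨w, rfl, hw'⟩ := exists_eq_X_sub_C_mul hw h1
    obtain ⟨x, rfl, hx'⟩ := exists_eq_X_sub_C_mul hx h2
    obtain ⟨y, rfl, hy'⟩ := exists_eq_X_sub_C_mul hy h3
    obtain ⟨z, rfl, hz'⟩ := exists_eq_X_sub_C_mul hz h4
    have hd : m ∣ (X - C r) ^ 2 * quaternionNormForm (C a) (C b) w x y z :=
      ⟨g, by rw [← hg]; simp only [quaternionNormForm]; ring⟩
    have hnd : ¬ m ∣ (X - C r) ^ 2 := fun hd => by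
      have := natDegree_le_of_dvd (hirr.prime.dvd_of_dvd_pow hd) (X_sub_C_ne_zero r)
      rw [natDegree_X_sub_C] at this
      omega
    obtain ⟨rfl, rfl, rfl, rfl⟩ := h.eq_zero_of_dvd_of_natDegree_le_one hm hw' hx' hy' hz'
      ((hirr.prime.dvd_or_dvd hd).resolve_left hnd)
    simp

theorem exists_aeval_eq_of_adjoin_eq_top {K : Type*} [Field K] [Algebra F K] {β : K}
    (hβ : IsIntegral F β) (htop : IntermediateField.adjoin F {β} = ⊤) (u : K) :
    ∃ f : F[X], f.natDegree ≤ (minpoly F β).natDegree - 1 ∧ aeval β f = u := by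
  have hu : u ∈ (IntermediateField.adjoin F {β}).toSubalgebra := by simp [htop]
  rw [IntermediateField.adjoin_simple_toSubalgebra_of_isAlgebraic hβ.isAlgebraic,
    Algebra.adjoin_singleton_eq_range_aeval] at hu
  obtain ⟨f, rfl⟩ := hu
  refine ⟨f %ₘ minpoly F β, ?_, ?_⟩
  · have := natDegree_modByMonic_lt f (minpoly.monic hβ) (minpoly.ne_one F β)
    omega
  · exact (aeval_modByMonic_eq_self_of_root (minpoly.aeval F β))

/-- Springer's theorem for the norm form of a quaternion algebra and a cubic extension. -/
theorem NormFormAnisotropic.of_cubic [Infinite F] {K : Type*} [Field K] [Algebra F K] {β : K}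
    (h : NormFormAnisotropic a b) (hβ : IsIntegral F β)
    (htop : IntermediateField.adjoin F {β} = ⊤) (hdeg : (minpoly F β).natDegree = 3) :
    NormFormAnisotropic (algebraMap F K a) (algebraMap F K b) := by
  intro w x y z h0
  have ex := exists_aeval_eq_of_adjoin_eq_top hβ htop
  rw [hdeg] at ex
  obtain ⟨w, hw, rfl⟩ := ex w
  obtain ⟨x, hx, rfl⟩ := ex x
  obtain ⟨y, hy, rfl⟩ := ex y
  obtain ⟨z, hz, rfl⟩ := ex z
  obtain ⟨rfl, rfl, rfl, rfl⟩ := h.eq_zero_of_dvd_of_natDegree_le_two (minpoly.irreducible hβ)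
    hdeg hw hx hy hz (minpoly.dvd F β (by simpa [quaternionNormForm] using h0))
  simp

end Springer

/-! ### Adjoining a cube root -/

theorem IsPrimitiveRoot.sq_add_self_add_one {R : Type*} [CommRing R] [IsDomain R] {ω : R}
    (hω : IsPrimitiveRoot ω 3) : ω ^ 2 + ω + 1 = 0 := by
  have := hω.geom_sum_eq_zero (by norm_num)
  rw [Finset.sum_range_succ, Finset.sum_range_succ, Finset.sum_range_one, pow_zero,
    pow_one] at this
  linear_combination this

/-- Adjoining a cube root in the presence of the cube roots of unity yields an extension
of degree one or three. -/
theorem mem_range_or_natDegree_minpoly_eq_three {F K : Type*} [Field F] [Field K] [Algebra F K]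
    {ω c : F} {β : K} (hω : IsPrimitiveRoot ω 3) (hβ : β ^ 3 = algebraMap F K c) :
    β ∈ (algebraMap F K).range ∨ (minpoly F β).natDegree = 3 := by
  by_cases hc : ∃ r : F, r ^ 3 = c
  · obtain ⟨r, rfl⟩ := hc
    left
    have hω' : algebraMap F K (ω ^ 2 + ω + 1) = 0 := by
      rw [hω.sq_add_self_add_one, map_zero]
    simp only [map_add, map_one, map_pow] at hω' hβ
    have hprod : (β - algebraMap F K r) * ((β - algebraMap F K (ω * r)) *
        (β - algebraMap F K (ω ^ 2 * r))) = 0 := by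
      simp only [map_mul, map_pow]
      generalize algebraMap F K ω = o at *
      generalize algebraMap F K r = q at *
      linear_combination hβ + (β * q ^ 2 * o  - β ^ 2 * q - (o - 1) * q ^ 3) * hω'
    rcases mul_eq_zero.1 hprod with h | h
    · exact ⟨r, (sub_eq_zero.1 h).symm⟩
    · rcases mul_eq_zero.1 h with h | h
      · exact ⟨ω * r, (sub_eq_zero.1 h).symm⟩
      · exact ⟨ω ^ 2 * r, (sub_eq_zero.1 h).symm⟩
  · right
    have hirr := X_pow_sub_C_irreducible_of_prime Nat.prime_three
      (a := c) fun r hr => hc ⟨r, hr⟩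
    rw [← minpoly.eq_of_irreducible_of_monic hirr (by simp [hβ])
      (Polynomial.monic_X_pow_sub_C c three_ne_zero), Polynomial.natDegree_X_pow_sub_C]

/-- The degree one case does occur: for α = -1, c is a cube in F. -/
theorem NormFormAnisotropic.of_cube_root {F K : Type*} [Field F] [Infinite F] [Field K]
    [Algebra F K] {a b ω c : F} {β : K} (h : NormFormAnisotropic a b) (hω : IsPrimitiveRoot ω 3)
    (hβ : β ^ 3 = algebraMap F K c) (htop : IntermediateField.adjoin F {β} = ⊤) :
    NormFormAnisotropic (algebraMap F K a) (algebraMap F K b) := by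
  rcases mem_range_or_natDegree_minpoly_eq_three hω hβ with hmem | hdeg
  · have hbot : (⊥ : IntermediateField F K) = ⊤ := by
      rw [← htop, eq_comm, IntermediateField.adjoin_simple_eq_bot_iff, IntermediateField.mem_bot]
      exact hmem
    have hs (u : K) : ∃ v, algebraMap F K v = u :=
      IntermediateField.mem_bot.1 (hbot ▸ IntermediateField.mem_top)
    intro w x y z h0
    obtain ⟨w, rfl⟩ := hs w
    obtain ⟨x, rfl⟩ := hs x
    obtain ⟨y, rfl⟩ := hs y
    obtain ⟨z, rfl⟩ := hs z
    rw [← quaternionNormForm_map, map_eq_zero] at h0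
    obtain ⟨rfl, rfl, rfl, rfl⟩ := h _ _ _ _ h0
    simp
  · exact h.of_cubic (IsIntegral.of_pow three_pos (hβ ▸ isIntegral_algebraMap)) htop hdeg
-- Anisotropy and cube roots of unity over ℚ_p
section Padic

variable {p : ℕ} [Fact p.Prime]

theorem norm_sq_sub_two_eq_one (h2 : ¬ IsSquare (2 : ZMod p)) (u : ℤ_[p]) :
    ‖u ^ 2 - 2‖ = 1 := by
  rw [← PadicInt.isUnit_iff]
  by_contra hu
  have hmem : u ^ 2 - 2 ∈ RingHom.ker (PadicInt.toZMod (p := p)) := by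
    rw [PadicInt.ker_toZMod]
    exact (IsLocalRing.mem_maximalIdeal _).2 hu
  rw [RingHom.mem_ker, map_sub, map_pow, map_ofNat, sub_eq_zero] at hmem
  exact h2 ⟨PadicInt.toZMod u, by rw [← hmem, sq]⟩

theorem Padic.norm_two_le_one : ‖(2 : ℚ_[p])‖ ≤ 1 := by
  simpa using Padic.norm_int_le_one (p := p) 2

/-- If `2` is not a square modulo `p`, then `x² - 2 y²` has even valuation. -/
theorem exists_norm_sq_sub_two_mul_sq (h2 : ¬ IsSquare (2 : ZMod p)) (x y : ℚ_[p]) :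
    ∃ w : ℚ_[p], ‖x ^ 2 - 2 * y ^ 2‖ = ‖w‖ ^ 2 ∧ (w = 0 → x = 0 ∧ y = 0) := by
  -- The witness is the entry of larger norm: either y² factors out and leaves a unit, or x²
  -- strictly dominates 2y².
  rcases le_or_gt ‖x‖ ‖y‖ with hxy | hxy
  · refine ⟨y, ?_, fun hy => ⟨?_, hy⟩⟩
    · rcases eq_or_ne y 0 with rfl | hy
      · simp_all
      · have hu : ‖x / y‖ ≤ 1 := by
          rw [norm_div]
          exact div_le_one_of_le₀ hxy (norm_nonneg _)
        have := norm_sq_sub_two_eq_one h2 ⟨x / y, hu⟩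
        rw [PadicInt.norm_def] at this
        change ‖(x / y) ^ 2 - 2‖ = 1 at this
        rw [show x ^ 2 - 2 * y ^ 2 = ((x / y) ^ 2 - 2) * y ^ 2 by field_simp, norm_mul,
          norm_pow y]
        rw [this, one_mul]
    · rw [hy, norm_zero] at hxy
      exact norm_le_zero_iff.1 hxy
  · refine ⟨x, ?_, fun hx => ?_⟩
    · have hlt : ‖2 * y ^ 2‖ < ‖x ^ 2‖ := by
        rw [norm_mul, norm_pow, norm_pow]
        calc ‖(2 : ℚ_[p])‖ * ‖y‖ ^ 2 ≤ 1 * ‖y‖ ^ 2 := by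
              gcongr
              exact Padic.norm_two_le_one
          _ < ‖x‖ ^ 2 := by
              rw [one_mul]
              gcongr
      rw [← norm_pow, sub_eq_add_neg, Padic.add_eq_max_of_ne (by rw [norm_neg]; exact hlt.ne'),
        norm_neg, max_eq_left hlt.le]
    · rw [hx, norm_zero] at hxy
      exact absurd hxy (norm_nonneg y).not_gt

/-- A zero gives w² - 2y² = p(x² - 2z²), with even valuation on the left and odd on the right unless
both sides vanish. -/
theorem normFormAnisotropic_padic (h2 : ¬ IsSquare (2 : ZMod p)) :
    NormFormAnisotropic (p : ℚ_[p]) 2 := by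
  intro w x y z h0
  obtain ⟨u, hu, hu0⟩ := exists_norm_sq_sub_two_mul_sq h2 w y
  obtain ⟨v, hv, hv0⟩ := exists_norm_sq_sub_two_mul_sq h2 x z
  have h : w ^ 2 - 2 * y ^ 2 = p * (x ^ 2 - 2 * z ^ 2) := by
    rw [quaternionNormForm] at h0
    linear_combination h0
  have hn := congrArg norm h
  rw [norm_mul, hu, hv] at hn
  have hp0 : (p : ℚ_[p]) ≠ 0 := by exact_mod_cast (Fact.out : p.Prime).ne_zero
  have hv' : v = 0 := by
    by_contra hv'
    have hu' : u ≠ 0 := by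
      rintro rfl
      simp_all
    rw [← norm_pow, ← norm_pow, ← norm_mul, Padic.norm_eq_zpow_neg_valuation (by positivity),
      Padic.norm_eq_zpow_neg_valuation (by positivity)] at hn
    have hp1 : (1 : ℝ) < p := by exact_mod_cast (Fact.out : p.Prime).one_lt
    have := zpow_right_injective₀ (by linarith) hp1.ne' hn
    rw [Padic.valuation_mul hp0 (by positivity), Padic.valuation_pow, Padic.valuation_pow,
      Padic.valuation_p] at this
    omega
  have hu' : u = 0 := by
    simpa [hv'] using hn
  exact ⟨(hu0 hu').1, (hv0 hv').1, (hu0 hu').2, (hv0 hv').2⟩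

theorem exists_sq_add_self_add_one_eq_zero_padic (hp2 : p ≠ 2) (h : legendreSym p (-3) = 1) :
    ∃ ω : ℚ_[p], ω ^ 2 + ω + 1 = 0 := by
  have hp : p.Prime := Fact.out
  have h3 : ((-3 : ℤ) : ZMod p) ≠ 0 := by
    rw [Ne, ← legendreSym.eq_zero_iff, h]
    exact one_ne_zero
  obtain ⟨t, ht⟩ := (legendreSym.eq_one_iff p h3).1 h
  push_cast at ht
  have h2 : (2 : ZMod p) ≠ 0 := by
    intro h2
    exact hp2 ((Nat.prime_dvd_prime_iff_eq hp Nat.prime_two).1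
      ((ZMod.natCast_eq_zero_iff 2 p).1 (by exact_mod_cast h2)))
  -- With t² = -3, (t - 1)/2 is a root of X² + X + 1 mod p, where the derivative is t ≠ 0, so
  -- Hensel's lemma applies.
  obtain ⟨u, hu⟩ := ZMod.ringHom_surjective (PadicInt.toZMod (p := p)) ((t - 1) / 2)
  have unit_iff (x : ℤ_[p]) : ‖x‖ < 1 ↔ PadicInt.toZMod x = 0 := by
    rw [← RingHom.mem_ker, PadicInt.ker_toZMod, IsLocalRing.mem_maximalIdeal,
      PadicInt.mem_nonunits]
  let f : Polynomial ℤ_[p] := Polynomial.X ^ 2 + Polynomial.X + 1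
  have hf : ‖f.aeval u‖ < 1 := by
    rw [unit_iff]
    simp only [f, map_add, map_pow, Polynomial.aeval_X, map_one, hu]
    field_simp
    linear_combination -ht
  have hf' : ‖f.derivative.aeval u‖ = 1 := by
    refine le_antisymm (PadicInt.norm_le_one _) (not_lt.1 fun hlt => ?_)
    rw [unit_iff] at hlt
    simp [f, hu] at hlt
    rw [one_add_one_eq_two, mul_div_cancel₀ _ h2, sub_add_cancel] at hlt
    rw [hlt, mul_zero] at ht
    exact h3 (by exact_mod_cast ht)
  obtain ⟨z, hz, -⟩ := hensels_lemma (p := p) (F := f) (a := u) (by rw [hf']; simpa using hf)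
  refine ⟨z, ?_⟩
  simp only [f, map_add, map_pow, Polynomial.aeval_X, map_one] at hz
  simpa using congrArg ((↑) : ℤ_[p] → ℚ_[p]) hz

end Padic

/-! ### Representing p by 2y² + 3w² -/

/-- Thue's lemma. -/
theorem exists_small_modEq {p : ℕ} [Fact p.Prime] (t : ZMod p) :
    ∃ x y : ℤ, (x : ZMod p) = t * y ∧ (x ≠ 0 ∨ y ≠ 0) ∧ x ^ 2 < p ∧ y ^ 2 < p := by
  classical
  have hp : p.Prime := Fact.out
  set n := Nat.sqrt p
  let S := Finset.range (n + 1) ×ˢ Finset.range (n + 1)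
  -- Pigeonhole: there are (n + 1)² > p pairs but only p residues.
  obtain ⟨u, hu, v, hv, huv, heq⟩ := Finset.exists_ne_map_eq_of_card_lt_of_maps_to
    (s := S) (t := (Finset.univ : Finset (ZMod p))) (f := fun q => (q.1 : ZMod p) - t * q.2)
    (by simpa [S, ZMod.card] using Nat.lt_succ_sqrt p) (fun _ _ => Finset.mem_univ _)
  simp only [S, Finset.mem_product, Finset.mem_range] at hu hv
  have hn : (n : ℤ) ^ 2 < p := by
    have h1 : n ^ 2 ≤ p := Nat.sqrt_le' p
    have h2 : n ^ 2 ≠ p := fun h => hp.not_isSquare ⟨n, by rw [← h, sq]⟩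
    exact_mod_cast lt_of_le_of_ne h1 h2
  refine ⟨(u.1 : ℤ) - v.1, (u.2 : ℤ) - v.2, ?_, ?_, ?_, ?_⟩
  · push_cast
    linear_combination heq
  · by_contra! hc
    exact huv (Prod.ext (by omega) (by omega))
  · refine lt_of_le_of_lt (sq_le_sq.2 ?_) hn
    rw [Nat.abs_cast, abs_le]
    omega
  · refine lt_of_le_of_lt (sq_le_sq.2 ?_) hn
    rw [Nat.abs_cast, abs_le]
    omega

/-- Both -2 and 3 are squares mod p, so -6 is, and Thue's lemma gives x² + 6y² = kp with 0 < k < 7.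
Modulo 3, k = 1 and k = 4 are impossible, and k = 6 descends to k = 1; for k = 2, 3, 5 dividing by k
yields the form 2y² + 3w². -/
theorem exists_eq_two_mul_sq_add_three_mul_sq {p : ℕ} [Fact p.Prime] (hp8 : p % 8 = 3)
    (hp3 : p % 3 = 2) : ∃ y w : ℤ, (p : ℤ) = 2 * y ^ 2 + 3 * w ^ 2 := by
  have hp : p.Prime := Fact.out
  have hns : ¬ IsSquare ((2 : ℕ) : ZMod 3) := by decide
  have : Fact (Nat.Prime 3) := ⟨Nat.prime_three⟩
  obtain ⟨t, ht⟩ : IsSquare (-6 : ZMod p) := by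
    have h2 : IsSquare (-2 : ZMod p) :=
      (ZMod.exists_sq_eq_neg_two_iff (by omega)).2 (Or.inr hp8)
    have h3 : IsSquare ((3 : ℕ) : ZMod p) := by
      rw [ZMod.exists_sq_eq_prime_iff_of_mod_four_eq_three (by omega) (by norm_num) (by omega),
        ← ZMod.natCast_mod, hp3]
      exact hns
    have := h2.mul h3
    norm_num at this
    exact this
  obtain ⟨x, y, hxy, hne, hx, hy⟩ := exists_small_modEq t
  have hdvd : (p : ℤ) ∣ x ^ 2 + 6 * y ^ 2 := by
    rw [← ZMod.intCast_zmod_eq_zero_iff_dvd]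
    push_cast
    rw [hxy]
    linear_combination -(y : ZMod p) ^ 2 * ht
  obtain ⟨k, hk⟩ := hdvd
  have hppos : (0 : ℤ) < p := by exact_mod_cast hp.pos
  have hpos : 0 < x ^ 2 + 6 * y ^ 2 := by
    rcases hne with h | h <;> positivity
  have hk0 : 0 < k := by
    rw [hk] at hpos
    exact (mul_pos_iff_of_pos_left hppos).1 hpos
  have hk7 : k < 7 := by
    refine lt_of_mul_lt_mul_left (a := (p : ℤ)) ?_ hppos.le
    linarith
  have hmod {k : ℤ} {x y : ℤ} (h : x ^ 2 + 6 * y ^ 2 = p * k) (hk : k % 3 = 1) : False := by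
    have h1 : (x ^ 2 + 6 * y ^ 2) % 3 = x ^ 2 % 3 := by omega
    have h2 : (p * k : ℤ) % 3 = 2 := by
      rw [Int.mul_emod, hk]
      omega
    have h3 : x ^ 2 % 3 = 0 ∨ x ^ 2 % 3 = 1 := by
      rcases (by omega : x % 3 = 0 ∨ x % 3 = 1 ∨ x % 3 = 2) with h | h | h <;>
        simp [sq, Int.mul_emod, h]
    omega
  have even {x : ℤ} (c : ℤ) (h : x ^ 2 = 2 * c) : ∃ d, x = 2 * d :=
    (Int.prime_two.dvd_of_dvd_pow (Dvd.intro _ h.symm))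
  have three {x : ℤ} (c : ℤ) (h : x ^ 2 = 3 * c) : ∃ d, x = 3 * d :=
    (Int.prime_three.dvd_of_dvd_pow (Dvd.intro _ h.symm))
  -- For k = 5, 6 ≡ -4 · 4 ⁻¹ · 4 mod 5 is read as 6 ≡ -4, so x ≡ ±2y mod 5.
  have five (c : ℤ) (h : x ^ 2 - 4 * y ^ 2 = 5 * c) : (∃ d, x = 2 * y + 5 * d) ∨
      ∃ d, x = -(2 * y) + 5 * d := by
    have h5 : (5 : ℤ) ∣ (x - 2 * y) * (x + 2 * y) := ⟨c, by linear_combination h⟩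
    rcases (Nat.prime_iff_prime_int.1 Nat.prime_five).dvd_or_dvd h5 with ⟨d, hd⟩ | ⟨d, hd⟩
    · exact Or.inl ⟨d, by push_cast at hd; linarith⟩
    · exact Or.inr ⟨d, by push_cast at hd; linarith⟩
  interval_cases k
  · exact (hmod hk (by norm_num)).elim
  · obtain ⟨d, rfl⟩ := even (x := x) (p - 3 * y ^ 2) (by linarith)
    exact ⟨d, y, by linarith⟩
  · obtain ⟨d, rfl⟩ := three (x := x) (p - 2 * y ^ 2) (by linarith)
    exact ⟨y, d, by linarith⟩
  · exact (hmod hk (by norm_num)).elim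
  · rcases five (p - 2 * y ^ 2) (by linarith) with ⟨d, rfl⟩ | ⟨d, rfl⟩
    · exact ⟨y + d, d, by linarith⟩
    · exact ⟨d - y, d, by linarith⟩
  · obtain ⟨d, rfl⟩ := even (x := x) (3 * p - 3 * y ^ 2) (by linarith)
    obtain ⟨e, rfl⟩ : ∃ e, d = 3 * e := by
      obtain ⟨e, he⟩ := three (x := 2 * d) (2 * p - 2 * y ^ 2) (by linarith)
      exact ⟨d - e, by omega⟩
    exact (hmod (k := 1) (x := y) (y := e) (by linarith) (by norm_num)).elim

/-- For p ≡ 3 mod 4, reciprocity gives (-3/p) = (p/3), which is 1 when p ≡ 1 mod 3. -/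
theorem mod_three_eq_two_of_legendreSym_ne_one {p : ℕ} [Fact p.Prime] (hp4 : p % 4 = 3) (hp3 : p ≠ 3)
    (h : legendreSym p (-3) ≠ 1) : p % 3 = 2 := by
  have hp : p.Prime := Fact.out
  have : Fact (Nat.Prime 3) := ⟨Nat.prime_three⟩
  have h0 : p % 3 ≠ 0 := fun h0 =>
    hp3 ((Nat.prime_dvd_prime_iff_eq Nat.prime_three hp).1 (Nat.dvd_of_mod_eq_zero h0)).symm
  have h1 : p % 3 ≠ 1 := fun h1 => by
    apply h
    rw [← neg_one_mul, legendreSym.mul, legendreSym.at_neg_one (by omega),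
      ZMod.χ₄_nat_three_mod_four hp4]
    have := legendreSym.quadratic_reciprocity_three_mod_four (p := 3) (q := p) (by norm_num) hp4
    rw [Nat.cast_ofNat] at this
    rw [this, legendreSym.mod, show ((p : ℤ) % (3 : ℕ)) = 1 by omega, legendreSym.at_one]
    norm_num
  omega

theorem exists_eq_two_mul_sq_add_three_mul_sq_of_legendreSym {p : ℕ} [Fact p.Prime]
    (hp8 : p % 8 = 3) (h : legendreSym p (-3) ≠ 1) :
    ∃ y w : ℤ, (p : ℤ) = 2 * y ^ 2 + 3 * w ^ 2 := by
  rcases eq_or_ne p 3 with rfl | hp3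
  · exact ⟨0, 1, by norm_num⟩
  · exact exists_eq_two_mul_sq_add_three_mul_sq hp8 (mod_three_eq_two_of_legendreSym_ne_one (by omega) hp3 h)

/-! ### The tower ℚ ⊆ ℚ(ε) ⊆ K and the main theorem -/

theorem adjoin_adjoin_simple_eq_top {k K : Type*} [Field k] [Field K] [Algebra k K] {x y : K}
    (h : IntermediateField.adjoin k {x, y} = ⊤) :
    IntermediateField.adjoin (IntermediateField.adjoin k {x}) {y} = ⊤ := by
  rw [← IntermediateField.restrictScalars_eq_top_iff (K := k),
    IntermediateField.adjoin_simple_adjoin_simple, h]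

theorem nonempty_algHom_adjoin_of_isPrimitiveRoot_three {K L : Type*} [Field K] [CharZero K]
    [Field L] [CharZero L] {ε : K} {ω : L} (hε : IsPrimitiveRoot ε 3) (hω : ω ^ 2 + ω + 1 = 0) :
    Nonempty (IntermediateField.adjoin ℚ {ε} →ₐ[ℚ] L) := by
  have hint : IsIntegral ℚ ε := (hε.isIntegral three_pos).tower_top
  refine ⟨(IntermediateField.algHomAdjoinIntegralEquiv ℚ hint).symm ⟨ω, ?_⟩⟩
  rw [Polynomial.mem_aroots, ← Polynomial.cyclotomic_eq_minpoly_rat hε three_pos,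
    Polynomial.cyclotomic_three]
  refine ⟨?_, by simpa using hω⟩
  rw [← Polynomial.cyclotomic_three]
  exact Polynomial.cyclotomic_ne_zero 3 ℚ

theorem mainTheorem6 {K : Type*} [Field K] [CharZero K]
    (ε β : K) (α : ℤ)
    (hε : IsPrimitiveRoot ε 3)
    (hα0 : α ≠ 0) (hα1 : α ≠ 1) (hα : IsCubefree α)
    (hβ : β ^ 3 = (α : K))
    (hK : IntermediateField.adjoin ℚ ({ε, β} : Set K) = ⊤)
    (p : ℕ) [Fact p.Prime] (hp : p % 8 = 3) :
    IsDivisionAlgebra (quaternionAlg K (p : K) (2 : K)) ↔ legendreSym p (-3) = 1 := by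
  constructor
  · intro hdiv
    by_contra h
    obtain ⟨y, w, hyw⟩ := exists_eq_two_mul_sq_add_three_mul_sq_of_legendreSym hp h
    -- Since (2ε + 1)² = -3, t² = -3w² = 2y² - p = p + 2y² - 2p.
    refine not_isDivisionAlgebra_quaternionAlg (t := (2 * ε + 1) * w) (y := (y : K)) ?_ hdiv
    have hyw' : (p : K) = 2 * (y : K) ^ 2 + 3 * (w : K) ^ 2 := by exact_mod_cast hyw
    linear_combination 4 * (w : K) ^ 2 * hε.sq_add_self_add_one + hyw'
  · intro h
    have hp2 : p ≠ 2 := by omega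
    have h2 : ¬ IsSquare (2 : ZMod p) := by
      rw [ZMod.exists_sq_eq_two_iff hp2]
      omega
    obtain ⟨ω, hω⟩ := exists_sq_add_self_add_one_eq_zero_padic hp2 h
    obtain ⟨φ⟩ := nonempty_algHom_adjoin_of_isPrimitiveRoot_three hε hω
    let F := IntermediateField.adjoin ℚ {ε}
    have hF : NormFormAnisotropic (p : F) 2 :=
      NormFormAnisotropic.of_injective (f := φ.toRingHom) φ.injective
        (by rw [map_natCast, map_ofNat]; exact normFormAnisotropic_padic h2)
    have hεF : IsPrimitiveRoot (IntermediateField.AdjoinSimple.gen ℚ ε) 3 :=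
      IsPrimitiveRoot.of_map_of_injective (f := algebraMap F K)
        (by simpa using hε) (algebraMap F K).injective
    have htop : IntermediateField.adjoin F {β} = ⊤ := adjoin_adjoin_simple_eq_top hK
    have := hF.of_cube_root (c := (α : F)) (β := β) hεF (by simpa using hβ) htop
    exact isDivisionAlgebra_quaternionAlg (by rwa [map_natCast, map_ofNat] at this)
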